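/- Let $A,B:\mathbb R^n\rightrightarrows\mathbb R^n$ be piecewise polyhedral set-valued mappings, i.e. the graph of each is a union of finitely many polyhedral sets. Let $$T_{\mathrm{PD}}(x,y)=\big(Ax\times B^{-1}y\big)+(y,-x),\qquad (x,y)\in\mathbb R^{2n},$$ and suppose that $\operatorname{zer}T_{\mathrm{PD}}=\{z : 0\in T_{\mathrm{PD}}z\}$ is nonempty, closed and convex. Suppose that there are $\beta_{\mathrm P},\beta_{\mathrm D}\in\mathbb R$ with $\min\{0,\beta_{\mathrm D}\}\min\{0,\beta_{\mathrm P}\}<\tfrac14$ such that, with $V=\operatorname{blkdiag}(\beta_{\mathrm P}I_n,\beta_{\mathrm D}I_n)$, $$\langle w,z-z^\star\rangle\ \ge\ \langle w,Vw\rangle\qquad\text{for all } z^\star\in\operatorname{zer}T_{\mathrm{PD}}\text{ and all }(z,w)\in\operatorname{graph}T_{\mathrm{PD}}.$$ Let $$\gamma\in\left(\frac{2[-\beta_{\mathrm P}]_+}{1+\sqrt{1-4\beta_{\mathrm D}\beta_{\mathrm P}}},\ \frac{1+\sqrt{1-4\beta_{\mathrm D}\beta_{\mathrm P}}}{2[-\beta_{\mathrm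 D}]_+}\right),\qquad [t]_+=\max\{0,t\},$$ where the right end point is $+\infty$ if $\beta_{\mathrm D}\ge0$, and the interval is $(0,+\infty)$ if $\beta_{\mathrm P},\beta_{\mathrm D}\ge0$. Suppose that the resolvents $J_{\gamma A}=(\mathrm{id}+\gamma A)^{-1}$ and $J_{\gamma B}=(\mathrm{id}+\gamma B)^{-1}$ have full domain and are (single-valued and) continuous. Put $\alpha=1+\tfrac1\gamma\beta_{\mathrm P}+\gamma\beta_{\mathrm D}$, and let $\lambda_k\in(0,2\alpha)$, $k\in\mathbb N$, satisfy $\liminf_{k\to\infty}\lambda_k(2\alpha-\lambda_k)>0$. Let $(u^k,v^k,s^k)_{k\in\mathbb N}$ be generated from some $s^0\in\mathbb R^n$ by the relaxed Douglas--Rachford splitting (DRS) $$u^k\in J_{\gamma A}(s^k),\qquad v^k\in J_{\gamma B}(2u^k-s^k),\qquad s^{k+1}=s^k+\lambda_k(v^k-u^k).$$ Then $(s^k)$ converges $R$-linearly to some element of $\{x^\star-\gamma y^\star : (x^\star,y^\star)\in\operatorname{zer}T_{\mathrm{PD}}\}$, and $(\|u^k-v^k\|)$ converges $R$-linearly to zero.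 Here $(x^k)$ converges $R$-linearly to $\bar x$ if there are reals $r_k\ge0$ with $\|x^k-\bar x\|\le r_k$ for all $k$, a constant $c\in(0,1)$ and an index $k_0$ such that $r_{k+1}\le c\,r_k$ for all $k\ge k_0$. -/

import Mathlib

/-!
Set-valued operators on real inner product spaces, the primal-dual operator of the inclusion
`0 ∈ A x + B x`, and relaxed Douglas-Rachford splitting.  A set-valued operator `T : X ⇉ Y` is a
function `T : X → Set Y`.
-/

namespace DRS

noncomputable section

/-- The domain of a set-valued operator. -/
def dom {X Y : Type*} (T : X → Set Y) : Set X := {x | (T x).Nonempty}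

/-- The inverse of a set-valued operator: `x ∈ T⁻¹ y` if and only if `y ∈ T x`. -/
def inverse {X Y : Type*} (T : X → Set Y) : Y → Set X := fun y => {x | y ∈ T x}

/-- The set of zeros of a set-valued operator. -/
def zer {X Y : Type*} [Zero Y] (T : X → Set Y) : Set X := {x | (0 : Y) ∈ T x}

/-- The resolvent `J_{γ T} = (id + γ T)⁻¹`. -/
def resolvent {E : Type*} [AddCommGroup E] [Module ℝ E] (γ : ℝ) (T : E → Set E) : E → Set E :=
  inverse fun u => {s | ∃ a ∈ T u, s = u + γ • a}

/-- (Single-valued) continuity of a set-valued operator: on its domain it is given by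
a continuous function. -/
def IsContinuousOp {X Y : Type*} [TopologicalSpace X] [TopologicalSpace Y] (T : X → Set Y) :
    Prop :=
  ∃ f : X → Y, ContinuousOn f (dom T) ∧ ∀ x ∈ dom T, T x = {f x}

/-- A polyhedral set: the intersection of finitely many closed half-spaces. -/
def IsPolyhedral {H : Type*} [NormedAddCommGroup H] [InnerProductSpace ℝ H] (P : Set H) : Prop :=
  ∃ (m : ℕ) (a : Fin m → H) (b : Fin m → ℝ), P = {x | ∀ i, inner ℝ (a i) x ≤ b i}

/-- The graph of an operator, in the product carrying the Euclidean (`ℓ²`) structure. -/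
def graph {E : Type*} (T : E → Set E) : Set (WithLp 2 (E × E)) := {z | z.snd ∈ T z.fst}

/-- A piecewise polyhedral mapping: its graph is the union of finitely many polyhedral sets. -/
def IsPiecewisePolyhedral {E : Type*} [NormedAddCommGroup E] [InnerProductSpace ℝ E]
    (T : E → Set E) : Prop :=
  ∃ (m : ℕ) (P : Fin m → Set (WithLp 2 (E × E))),
    (∀ i, IsPolyhedral (P i)) ∧ graph T = ⋃ i, P i

/-- `T` has `V`-oblique weak Minty solutions at the nonempty set `S ⊆ zer T`, where `V` is a
symmetric (possibly indefinite) linear map: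
`⟨v, u - u⋆⟩ ≥ ⟨v, V v⟩` for all `u⋆ ∈ S` and all `(u, v)` in the graph of `T`. -/
def HasObliqueWeakMinty {H : Type*} [NormedAddCommGroup H] [InnerProductSpace ℝ H]
    (T : H → Set H) (V : H →ₗ[ℝ] H) (S : Set H) : Prop :=
  V.IsSymmetric ∧ S.Nonempty ∧ S ⊆ zer T ∧
    ∀ uStar ∈ S, ∀ u v : H, v ∈ T u → inner ℝ v (V v) ≤ inner ℝ v (u - uStar)

/-- The primal-dual operator `T_PD (x, y) = (A x) × (B⁻¹ y) + (y, -x)`. -/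
def primalDual {E : Type*} [AddCommGroup E] (A B : E → Set E) :
    WithLp 2 (E × E) → Set (WithLp 2 (E × E)) :=
  fun z => {w | ∃ a ∈ A z.fst, ∃ b ∈ inverse B z.snd,
    w = WithLp.toLp 2 (a + z.snd, b - z.fst)}

/-- The block diagonal map `blkdiag(βP I, βD I)` on `E × E`. -/
def blkdiag (E : Type*) [NormedAddCommGroup E] [InnerProductSpace ℝ E] (βP βD : ℝ) :
    WithLp 2 (E × E) →ₗ[ℝ] WithLp 2 (E × E) where
  toFun z := WithLp.toLp 2 (βP • z.fst, βD • z.snd)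
  map_add' z w := by
    simp [← WithLp.toLp_add, smul_add]
  map_smul' c z := by
    simp [← WithLp.toLp_smul, smul_comm c]

/-- The admissible stepsizes: the open interval from `2[-βP]₊ / (1 + √(1 - 4 βD βP))` to
`(1 + √(1 - 4 βD βP)) / (2[-βD]₊)`, where `[t]₊ = max 0 t` and the right end point is `+∞` when
`βD ≥ 0`.  (If `1 - 4 βD βP < 0` while `min 0 βD * min 0 βP < 1/4`, then `βP, βD > 0` and the
interval is `(0, +∞)`, whatever the value of the square root.) -/
def stepsizeRange (βP βD : ℝ) : Set ℝ :=
  {γ | 2 * max 0 (-βP) / (1 + √(1 - 4 * βD * βP)) < γ ∧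
    (βD < 0 → γ < (1 + √(1 - 4 * βD * βP)) / (2 * max 0 (-βD)))}

/-- `α = 1 + βP / γ + γ βD`. -/
def relaxConst (βP βD γ : ℝ) : ℝ := 1 + 1 / γ * βP + γ * βD

/-- `(u, v, s)` is generated by relaxed Douglas-Rachford splitting for `A + B` with stepsize `γ`
and relaxation parameters `lam`, started from `s 0`. -/
def IsDRSSequence {E : Type*} [AddCommGroup E] [Module ℝ E] (A B : E → Set E) (γ : ℝ)
    (lam : ℕ → ℝ) (u v s : ℕ → E) : Prop :=
  ∀ k, u k ∈ resolvent γ A (s k) ∧ v k ∈ resolvent γ B ((2 : ℝ) • u k - s k) ∧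
    s (k + 1) = s k + lam k • (v k - u k)

/-- `x` converges `Q`-linearly to `xStar`. -/
def QLinear {E : Type*} [NormedAddCommGroup E] (x : ℕ → E) (xStar : E) : Prop :=
  ∃ c ∈ Set.Ioo (0 : ℝ) 1, ∃ k₀ : ℕ, ∀ k ≥ k₀, ‖x (k + 1) - xStar‖ ≤ c * ‖x k - xStar‖

/-- `x` converges `R`-linearly to `xStar`: the distances to `xStar` are dominated by a sequence of
nonnegative reals that converges `Q`-linearly to zero. -/
def RLinear {E : Type*} [NormedAddCommGroup E] (x : ℕ → E) (xStar : E) : Prop :=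
  ∃ r : ℕ → ℝ, (∀ k, 0 ≤ r k) ∧ (∀ k, ‖x k - xStar‖ ≤ r k) ∧ QLinear r 0

end

end DRS

/-!
Fix a stepsize `γ > 0` and write `R s = J_{γB} (2 J_{γA} s - s) - J_{γA} s`, so that the iteration
is `s ↦ s + λ R s`.  The zeros of `R` are exactly the points `x⋆ - γ y⋆` with `(x⋆, y⋆)` a zero of
the primal-dual operator.  Evaluating the weak Minty inequality at the point of the graph of that
operator determined by `s` gives `α ‖R s‖² ≤ ⟪-R s, s - s⋆⟫` for every zero `s⋆` of `R`
(`minty_residual`).  Hence the iteration is Fejér monotone, and one step lowers `‖s - s⋆‖²` by at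
least `λ (2α - λ) ‖R s‖²`.

Piecewise polyhedrality supplies the complementary estimate `dist (s, zer R) ≤ κ ‖R s‖` for `s` in
a bounded set (`exists_errorBound`).  The triples `(s, u, v)` with `u = J_{γA} s` and
`v = J_{γB} (2u - s)` form a finite union of polyhedra, and on each of them `R s` is the linear
expression `v - u`.  If a polyhedron contains a point with `v = u`, the estimate is the Hoffman error
bound (`exists_hoffman_bound`); otherwise `‖v - u‖` is bounded away from zero on the part lying over
a compact set.  Working with triples avoids having to project polyhedra.

Together, the two estimates make `dist (s, zer R)` contract by a fixed factor (`rLinear_of_fejer`).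
The steps are bounded by a multiple of this distance, so the sequence converges geometrically.
-/

namespace DRS

open Filter Topology

/-! ### The Hoffman error bound -/

/-- **Hoffman's error bound.**  If a finite system of affine inequalities is solvable, then a point
violating each inequality by at most `ρ` lies within `κ * ρ` of a solution.  The proof minimizes
`κ * t + ‖z - x‖` over the points `(z, t)` such that `z` violates no inequality by more than
`t ≥ 0`.  At a minimizer with `t > 0`, moving towards a solution decreases all active constraints
at once; there are only finitely many active sets, so one `κ` makes this a strict descent. -/
theorem exists_hoffman_bound {H ι : Type*} [NormedAddCommGroup H] [NormedSpace ℝ H]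
    [FiniteDimensional ℝ H] [Finite ι] (ℓ : ι → H →L[ℝ] ℝ) (b : ι → ℝ)
    (hne : ∃ z, ∀ j, ℓ j z ≤ b j) :
    ∃ κ : ℝ, 0 ≤ κ ∧ ∀ (x : H) (ρ : ℝ), 0 ≤ ρ → (∀ j, ℓ j x ≤ b j + ρ) →
      ∃ z, (∀ j, ℓ j z ≤ b j) ∧ ‖x - z‖ ≤ κ * ρ := by
  classical
  obtain ⟨z₀, hz₀⟩ := hne
  have hd : ∀ J : Set ι, ∃ d : H, (∃ d', ∀ j ∈ J, ℓ j d' ≤ -1) → ∀ j ∈ J, ℓ j d ≤ -1 := by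
    intro J
    by_cases h : ∃ d', ∀ j ∈ J, ℓ j d' ≤ -1
    · exact ⟨h.choose, fun _ => h.choose_spec⟩
    · exact ⟨0, fun h' => absurd h' h⟩
  choose d hd using hd
  have : Fintype (Set ι) := Fintype.ofFinite _
  set κ : ℝ := 1 + ∑ J, ‖d J‖ with hκ
  have hdκ : ∀ J, ‖d J‖ < κ := fun J => by
    have := Finset.single_le_sum (f := fun J => ‖d J‖) (fun J _ => norm_nonneg _)
      (Finset.mem_univ J)
    linarith
  have hκ1 : 1 ≤ κ := by
    have : 0 ≤ ∑ J, ‖d J‖ := Finset.sum_nonneg fun J _ => norm_nonneg _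
    linarith
  refine ⟨κ, by linarith, fun x ρ hρ hx => ?_⟩
  let K : Set (H × ℝ) := {p | 0 ≤ p.2 ∧ ∀ j, ℓ j p.1 ≤ b j + p.2}
  have hK : IsClosed K := by
    have hj : ∀ j, IsClosed {p : H × ℝ | ℓ j p.1 ≤ b j + p.2} := fun j =>
      isClosed_le (by fun_prop) (by fun_prop)
    have h0 : IsClosed {p : H × ℝ | 0 ≤ p.2} := isClosed_le (by fun_prop) (by fun_prop)
    have : K = {p : H × ℝ | 0 ≤ p.2} ∩ ⋂ j, {p : H × ℝ | ℓ j p.1 ≤ b j + p.2} := by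
      ext p; simp [K]
    rw [this]
    exact h0.inter (isClosed_iInter hj)
  -- Competitors no worse than `(x, ρ)` lie in this compact box.
  let Q : Set (H × ℝ) := K ∩ (Metric.closedBall x (κ * ρ) ×ˢ Set.Icc 0 ρ)
  have hQ : IsCompact Q := ((isCompact_closedBall _ _).prod isCompact_Icc).inter_left hK
  have hxQ : (x, ρ) ∈ Q :=
    ⟨⟨hρ, hx⟩, Metric.mem_closedBall_self (by positivity), hρ, le_rfl⟩
  obtain ⟨⟨z, t⟩, ⟨⟨ht0, hz⟩, hzb⟩, hmin⟩ := hQ.exists_isMinOn ⟨_, hxQ⟩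
    (f := fun p : H × ℝ => κ * p.2 + ‖x - p.1‖) (by fun_prop)
  have hle : κ * t + ‖x - z‖ ≤ κ * ρ := by simpa using hmin hxQ
  simp only at ht0 hz
  rcases ht0.eq_or_lt with rfl | htpos
  · exact ⟨z, by simpa using hz, by simpa using hle⟩
  exfalso
  set J : Set ι := {j | ℓ j z = b j + t} with hJ
  have hdir : ∀ j ∈ J, ℓ j (d J) ≤ -1 := by
    refine hd J ⟨t⁻¹ • (z₀ - z), fun j hj => ?_⟩
    have h1 : ℓ j (z₀ - z) ≤ -t := by
      rw [map_sub, show ℓ j z = b j + t from hj]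
      linarith [hz₀ j]
    rw [map_smul, smul_eq_mul]
    calc t⁻¹ * ℓ j (z₀ - z) ≤ t⁻¹ * -t := by gcongr
      _ = -1 := by field_simp
  have hev : ∀ᶠ ε : ℝ in 𝓝[>] 0, 0 < ε ∧ ε < t ∧ ∀ j, ℓ j (z + ε • d J) ≤ b j + (t - ε) := by
    refine (eventually_mem_nhdsWithin).and (Eventually.and ?_ ?_)
    · exact nhdsWithin_le_nhds (Iio_mem_nhds htpos)
    · rw [eventually_all]
      intro j
      by_cases hj : j ∈ J
      · filter_upwards [eventually_mem_nhdsWithin] with ε hε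
        have hε' : 0 < ε := hε
        rw [map_add, map_smul, smul_eq_mul, show ℓ j z = b j + t from hj]
        nlinarith [hdir j hj]
      · have hlt : ℓ j z < b j + t := lt_of_le_of_ne (hz j) hj
        have hcont : Continuous fun ε : ℝ => ℓ j (z + ε • d J) - (b j + (t - ε)) := by fun_prop
        have := hcont.tendsto 0
        simp only [zero_smul, add_zero, sub_zero] at this
        have h2 := this.eventually (Iio_mem_nhds (sub_neg.2 hlt))
        filter_upwards [nhdsWithin_le_nhds h2] with ε hε
        have hε' : _ < (0 : ℝ) := hε
        linarith
  obtain ⟨ε, hε, hεt, hεj⟩ := hev.exists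
  have hnorm : ‖x - (z + ε • d J)‖ ≤ ‖x - z‖ + ε * ‖d J‖ := by
    rw [← sub_sub]
    refine (norm_sub_le _ _).trans ?_
    rw [norm_smul, Real.norm_of_nonneg hε.le]
  have hstrict : κ * (t - ε) + ‖x - (z + ε • d J)‖ < κ * t + ‖x - z‖ := by
    nlinarith [hdκ J]
  have hmem : (z + ε • d J, t - ε) ∈ Q := by
    refine ⟨⟨by simp only; linarith, hεj⟩, ?_, ?_, ?_⟩
    · rw [Metric.mem_closedBall, dist_comm, dist_eq_norm]
      have : 0 ≤ κ * (t - ε) := mul_nonneg (by linarith) (by linarith)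
      simp only
      linarith
    · simp only; linarith
    · have := hzb.2.2
      simp only at this ⊢
      linarith
  have := hmin hmem
  simp only [Set.mem_ofPred_eq] at this
  linarith

/-- On a polyhedron that meets the kernel of a linear map `L`, the distance to the intersection is
bounded by a multiple of `‖L x‖`.  This is Hoffman's bound with the equation `L x = 0` written as
two inequalities for every coordinate. -/
theorem exists_polyhedron_ker_bound {H ι : Type*} [NormedAddCommGroup H] [NormedSpace ℝ H]
    [FiniteDimensional ℝ H] [Finite ι] (ℓ : ι → H →L[ℝ] ℝ) (b : ι → ℝ) {n : ℕ}
    (L : H →L[ℝ] EuclideanSpace ℝ (Fin n)) (hne : ∃ z, (∀ j, ℓ j z ≤ b j) ∧ L z = 0) :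
    ∃ κ : ℝ, 0 ≤ κ ∧ ∀ x, (∀ j, ℓ j x ≤ b j) →
      ∃ z, (∀ j, ℓ j z ≤ b j) ∧ L z = 0 ∧ ‖x - z‖ ≤ κ * ‖L x‖ := by
  let c : Fin n → H →L[ℝ] ℝ := fun i => (EuclideanSpace.proj i : _ →L[ℝ] ℝ) ∘L L
  have hc : ∀ i x, c i x = L x i := fun i x => rfl
  obtain ⟨z₀, hz₀, hL₀⟩ := hne
  obtain ⟨κ, hκ, h⟩ := exists_hoffman_bound
    (Sum.elim ℓ (Sum.elim c (fun i => -c i))) (Sum.elim b 0)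
    ⟨z₀, by rintro (j | i | i) <;> simp [hz₀, hc, hL₀]⟩
  refine ⟨κ, hκ, fun x hx => ?_⟩
  obtain ⟨z, hz, hxz⟩ := h x ‖L x‖ (norm_nonneg _) (by
    rintro (j | i | i)
    · simpa using (hx j).trans (le_add_of_nonneg_right (norm_nonneg (L x)))
    · have := (le_abs_self _).trans (PiLp.norm_apply_le (L x) i)
      simpa [hc] using this
    · have := (neg_le_abs _).trans (PiLp.norm_apply_le (L x) i)
      simpa [hc] using this)
  refine ⟨z, fun j => by simpa using hz (Sum.inl j), ?_, hxz⟩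
  ext i
  have h1 := hz (Sum.inr (Sum.inl i))
  have h2 := hz (Sum.inr (Sum.inr i))
  simp [hc] at h1 h2
  simpa using le_antisymm h1 h2

/-! ### Geometric convergence of Fejér sequences under an error bound -/

theorem rLinear_of_geometric {E : Type*} [NormedAddCommGroup E] {x : ℕ → E} {xStar : E}
    {C c : ℝ} (hC : 0 ≤ C) (hc : c ∈ Set.Ioo (0 : ℝ) 1) (k₀ : ℕ)
    (h : ∀ k, ‖x (k + k₀) - xStar‖ ≤ C * c ^ k) : RLinear x xStar := by
  have hc0 := hc.1.le
  refine ⟨fun k => if k < k₀ then ‖x k - xStar‖ else C * c ^ (k - k₀), fun k => ?_, fun k => ?_,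
    c, hc, k₀, fun k hk => ?_⟩
  · dsimp only; split_ifs <;> positivity
  · dsimp only
    split_ifs with hk
    · exact le_rfl
    · have := h (k - k₀)
      rwa [Nat.sub_add_cancel (not_lt.1 hk)] at this
  · dsimp only
    rw [if_neg (by omega), if_neg (by omega), sub_zero, sub_zero, Nat.succ_sub hk, pow_succ,
      Real.norm_of_nonneg (by positivity), Real.norm_of_nonneg (by positivity)]
    exact le_of_eq (by ring)

section Fejer

variable {E : Type*} [NormedAddCommGroup E] [InnerProductSpace ℝ E]

/-- Distance decrease in one relaxed step with residual `r`. -/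
theorem norm_step_sq_le {s r z : E} {α l : ℝ} (hl : 0 ≤ l)
    (h : α * ‖r‖ ^ 2 ≤ inner ℝ (-r) (s - z)) :
    ‖s + l • r - z‖ ^ 2 ≤ ‖s - z‖ ^ 2 - l * (2 * α - l) * ‖r‖ ^ 2 := by
  have e : s + l • r - z = (s - z) + l • r := by abel
  rw [e, norm_add_sq_real, real_inner_smul_right, norm_smul, Real.norm_of_nonneg hl,
    real_inner_comm]
  rw [inner_neg_left] at h
  nlinarith

/-- If the residual steps satisfy the Fejér inequality with respect to a closed set `S` and the
residual bounds the distance to `S`, then the sequence converges `R`-linearly to a point of `S`, and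
so do the residuals to zero. -/
theorem rLinear_of_fejer [FiniteDimensional ℝ E] {S : Set E} (hS : IsClosed S)
    (hne : S.Nonempty) {s r : ℕ → E} {lam : ℕ → ℝ} {α ε κ : ℝ} (hα : 0 < α) (hε : 0 < ε)
    (hstep : ∀ k, s (k + 1) = s k + lam k • r k)
    (hlam : ∀ k, lam k ∈ Set.Ioo 0 (2 * α))
    (hlamε : ∀ᶠ k in atTop, ε ≤ lam k * (2 * α - lam k))
    (hfejer : ∀ k, ∀ z ∈ S, α * ‖r k‖ ^ 2 ≤ inner ℝ (-r k) (s k - z))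
    (herr : ∀ k, Metric.infDist (s k) S ≤ κ * ‖r k‖) :
    (∃ z ∈ S, RLinear s z) ∧ RLinear (fun k => ‖r k‖) 0 := by
  have : ProperSpace E := FiniteDimensional.proper ℝ E
  set d : ℕ → ℝ := fun k => Metric.infDist (s k) S with hd
  have hd0 : ∀ k, 0 ≤ d k := fun k => Metric.infDist_nonneg
  have hproj : ∀ k, ∃ z ∈ S, d k = ‖s k - z‖ := fun k => by
    obtain ⟨z, hz, h⟩ := hS.exists_infDist_eq_dist hne (s k)
    exact ⟨z, hz, by rw [hd, ← dist_eq_norm]; exact h⟩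
  have hrd : ∀ k, α * ‖r k‖ ≤ d k := fun k => by
    obtain ⟨z, hz, hdz⟩ := hproj k
    rw [hdz]
    have h1 := (hfejer k z hz).trans (real_inner_le_norm _ _)
    rw [norm_neg] at h1
    rcases (norm_nonneg (r k)).eq_or_lt with h0 | h0
    · rw [← h0, mul_zero]; exact norm_nonneg _
    · nlinarith
  -- Enlarging `κ` makes the contraction factor below well defined and positive.
  set κ' : ℝ := max κ (1 + ε) with hκ'
  have hκ'1 : 1 + ε ≤ κ' := le_max_right _ _
  have hκpos : 0 < κ' := by linarith
  have hratio0 : 0 < ε / κ' ^ 2 := by positivity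
  have hratio1 : ε / κ' ^ 2 < 1 := by
    rw [div_lt_one (by positivity)]
    nlinarith
  set c : ℝ := √(1 - ε / κ' ^ 2) with hc
  have hcsq : c ^ 2 = 1 - ε / κ' ^ 2 := Real.sq_sqrt (by linarith)
  have hc0 : 0 < c := Real.sqrt_pos.2 (by linarith)
  have hc1 : c < 1 := by
    rw [hc, Real.sqrt_lt' one_pos]
    linarith
  obtain ⟨k₀, hk₀⟩ := eventually_atTop.1 hlamε
  have hcontr : ∀ k ≥ k₀, d (k + 1) ≤ c * d k := fun k hk => by
    obtain ⟨z, hz, hdz⟩ := hproj k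
    have h1 : d (k + 1) ≤ ‖s (k + 1) - z‖ := by
      rw [← dist_eq_norm]; exact Metric.infDist_le_dist_of_mem hz
    have h2 := norm_step_sq_le (hlam k).1.le (hfejer k z hz)
    rw [← hstep, ← hdz] at h2
    have h3 : d k ≤ κ' * ‖r k‖ :=
      (herr k).trans (mul_le_mul_of_nonneg_right (le_max_left _ _) (norm_nonneg _))
    have h4 : ε / κ' ^ 2 * d k ^ 2 ≤ ε * ‖r k‖ ^ 2 := by
      calc ε / κ' ^ 2 * d k ^ 2 ≤ ε / κ' ^ 2 * (κ' * ‖r k‖) ^ 2 := by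
            have := hd0 k
            gcongr
        _ = ε * ‖r k‖ ^ 2 := by field_simp
    have h5 : ε * ‖r k‖ ^ 2 ≤ lam k * (2 * α - lam k) * ‖r k‖ ^ 2 :=
      mul_le_mul_of_nonneg_right (hk₀ k hk) (sq_nonneg _)
    refine le_of_sq_le_sq ?_ (mul_nonneg hc0.le (hd0 k))
    calc d (k + 1) ^ 2 ≤ ‖s (k + 1) - z‖ ^ 2 := by
          have := hd0 (k + 1)
          gcongr
      _ ≤ (1 - ε / κ' ^ 2) * d k ^ 2 := by linarith
      _ = (c * d k) ^ 2 := by rw [mul_pow, hcsq]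
  have hgeo : ∀ k, d (k + k₀) ≤ d k₀ * c ^ k := fun k => by
    induction k with
    | zero => simp
    | succ k ih =>
      calc d (k + 1 + k₀) = d (k + k₀ + 1) := by congr 1; omega
        _ ≤ c * d (k + k₀) := hcontr _ (by omega)
        _ ≤ c * (d k₀ * c ^ k) := by gcongr
        _ = d k₀ * c ^ (k + 1) := by ring
  have hdist : ∀ k, dist (s (k + k₀)) (s (k + 1 + k₀)) ≤ 2 * d k₀ * c ^ k := fun k => by
    have e : s (k + 1 + k₀) = s (k + k₀) + lam (k + k₀) • r (k + k₀) := by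
      rw [← hstep]; congr 1; omega
    rw [e, dist_self_add_right, norm_smul, Real.norm_of_nonneg (hlam _).1.le]
    have h1 : lam (k + k₀) * ‖r (k + k₀)‖ ≤ 2 * α * ‖r (k + k₀)‖ :=
      mul_le_mul_of_nonneg_right (hlam _).2.le (norm_nonneg _)
    linarith [hrd (k + k₀), hgeo k]
  obtain ⟨z, hz⟩ := cauchySeq_tendsto_of_complete
    (cauchySeq_of_le_geometric c (2 * d k₀) hc1 hdist)
  have hzS : z ∈ S := by
    rw [hS.mem_iff_infDist_zero hne]
    have h1 : Tendsto (fun k => d (k + k₀)) atTop (𝓝 (Metric.infDist z S)) :=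
      ((Metric.continuous_infDist_pt S).tendsto z).comp hz
    have h2 : Tendsto (fun k => d k₀ * c ^ k) atTop (𝓝 (d k₀ * 0)) :=
      (tendsto_pow_atTop_nhds_zero_of_lt_one hc0.le hc1).const_mul _
    rw [mul_zero] at h2
    exact le_antisymm (le_of_tendsto_of_tendsto' h1 h2 hgeo) Metric.infDist_nonneg
  refine ⟨⟨z, hzS, rLinear_of_geometric (C := 2 * d k₀ / (1 - c)) ?_ ⟨hc0, hc1⟩ k₀ fun k => ?_⟩,
    rLinear_of_geometric (C := d k₀ / α) ?_ ⟨hc0, hc1⟩ k₀ fun k => ?_⟩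
  · exact div_nonneg (mul_nonneg two_pos.le (hd0 _)) (by linarith)
  · rw [← dist_eq_norm]
    refine (dist_le_of_le_geometric_of_tendsto c (2 * d k₀) hc1 hdist hz k).trans (le_of_eq ?_)
    ring
  · exact div_nonneg (hd0 _) hα.le
  · rw [sub_zero, norm_norm, div_mul_eq_mul_div, le_div_iff₀ hα]
    linarith [hrd (k + k₀), hgeo k]

end Fejer

/-! ### The Douglas-Rachford residual -/

section Residual

variable {E : Type*} [NormedAddCommGroup E] [InnerProductSpace ℝ E]

theorem pos_of_mem_stepsizeRange {βP βD γ : ℝ} (h : γ ∈ stepsizeRange βP βD) : 0 < γ :=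
  lt_of_le_of_lt (by positivity) h.1

theorem mem_resolvent_iff {γ : ℝ} (hγ : γ ≠ 0) {T : E → Set E} {s u : E} :
    u ∈ resolvent γ T s ↔ γ⁻¹ • (s - u) ∈ T u := by
  constructor
  · rintro ⟨a, ha, rfl⟩
    simpa [smul_smul, hγ] using ha
  · intro h
    exact ⟨_, h, by simp [smul_smul, hγ]⟩

/-- The points `x⋆ - γ y⋆` with `(x⋆, y⋆)` a zero of the primal-dual operator, that is, the possible
limits of Douglas-Rachford splitting in the variable `s`. -/
def shadow (A B : E → Set E) (γ : ℝ) : Set E :=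
  (fun z : WithLp 2 (E × E) => z.fst - γ • z.snd) '' zer (primalDual A B)

/-- A point lies in the shadow set if and only if the two resolvent evaluations of
Douglas-Rachford splitting started there can return the same point. -/
theorem mem_shadow_iff {A B : E → Set E} {γ : ℝ} (hγ : γ ≠ 0) {s : E} :
    s ∈ shadow A B γ ↔
      ∃ u, u ∈ resolvent γ A s ∧ u ∈ resolvent γ B ((2 : ℝ) • u - s) := by
  constructor
  · rintro ⟨z, ⟨a, ha, b, hb, h0⟩, rfl⟩
    have h1 : a + z.snd = 0 := by
      simpa using (congrArg (fun w : WithLp 2 (E × E) => w.fst) h0).symm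
    have h2 : b = z.fst := by
      simpa [sub_eq_zero] using (congrArg (fun w : WithLp 2 (E × E) => w.snd) h0).symm
    subst h2
    obtain rfl : a = -z.snd := eq_neg_of_add_eq_zero_left h1
    refine ⟨z.fst, ⟨_, ha, ?_⟩, ⟨_, hb, ?_⟩⟩
    · dsimp only
      module
    · dsimp only
      module
  · rintro ⟨u, hA, hB⟩
    rw [mem_resolvent_iff hγ] at hA hB
    refine ⟨WithLp.toLp 2 (u, γ⁻¹ • (u - s)), ⟨_, hA, u, ?_, ?_⟩, ?_⟩
    · have e : (2 : ℝ) • u - s - u = u - s := by rw [two_smul]; abel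
      rw [e] at hB
      exact hB
    · have e : γ⁻¹ • (s - u) + γ⁻¹ • (u - s) = 0 := by
        rw [← smul_add]; simp
      change 0 = WithLp.toLp 2 (γ⁻¹ • (s - u) + γ⁻¹ • (u - s), u - u)
      rw [e, sub_self]
      rfl
    · simp [smul_smul, hγ]

theorem blkdiag_toLp (βP βD : ℝ) (a b : E) :
    blkdiag E βP βD (WithLp.toLp 2 (a, b)) = WithLp.toLp 2 (βP • a, βD • b) := rfl

/-- The weak Minty inequality in terms of the residual `v - u`. -/
theorem minty_residual {A B : E → Set E} {βP βD γ : ℝ} (hγ : 0 < γ)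
    (hM : HasObliqueWeakMinty (primalDual A B) (blkdiag E βP βD) (zer (primalDual A B)))
    {s u v z : E} (hu : u ∈ resolvent γ A s) (hv : v ∈ resolvent γ B ((2 : ℝ) • u - s))
    (hz : z ∈ shadow A B γ) :
    relaxConst βP βD γ * ‖v - u‖ ^ 2 ≤ inner ℝ (-(v - u)) (s - z) := by
  rw [mem_resolvent_iff hγ.ne'] at hu hv
  obtain ⟨p, hp, rfl⟩ := hz
  obtain ⟨-, -, -, h⟩ := hM
  have key := h p hp (WithLp.toLp 2 (u, γ⁻¹ • ((2 : ℝ) • u - s - v)))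
    (WithLp.toLp 2 (γ⁻¹ • (s - u) + γ⁻¹ • ((2 : ℝ) • u - s - v), v - u)) ⟨_, hu, _, hv, rfl⟩
  have e : γ⁻¹ • (s - u) + γ⁻¹ • ((2 : ℝ) • u - s - v) = -(γ⁻¹ • (v - u)) := by
    rw [← smul_add, ← smul_neg, two_smul]; congr 1; abel
  have e2 : γ⁻¹ • ((2 : ℝ) • u - s - v) - p.snd
      = γ⁻¹ • ((u - p.fst) - (v - u) - (s - (p.fst - γ • p.snd))) := by
    have : p.snd = γ⁻¹ • γ • p.snd := by rw [smul_smul, inv_mul_cancel₀ hγ.ne', one_smul]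
    nth_rw 1 [this]
    rw [← smul_sub, two_smul]; congr 1; abel
  rw [e] at key
  simp only [blkdiag_toLp, WithLp.prod_inner_apply, WithLp.ofLp_sub, Prod.fst_sub, Prod.snd_sub,
    WithLp.ofLp_fst, WithLp.ofLp_snd] at key
  rw [e2] at key
  simp only [inner_neg_left, inner_neg_right, real_inner_smul_left, real_inner_smul_right,
    smul_neg, inner_sub_right (v - u) _ (s - _), inner_sub_right (v - u) (u - p.fst) (v - u),
    real_inner_self_eq_norm_sq, norm_smul, norm_inv, Real.norm_of_nonneg hγ.le, mul_pow] at key ⊢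
  unfold relaxConst
  have hmul := mul_le_mul_of_nonneg_left key hγ.le
  field_simp at hmul ⊢
  nlinarith [hmul]

end Residual

/-! ### The error bound for piecewise polyhedral mappings -/

theorem isClosed_of_isPolyhedral {H : Type*} [NormedAddCommGroup H] [InnerProductSpace ℝ H]
    {P : Set H} (hP : IsPolyhedral P) : IsClosed P := by
  obtain ⟨m, a, b, rfl⟩ := hP
  rw [Set.ofPred_forall]
  exact isClosed_iInter fun i => isClosed_le (by fun_prop) (by fun_prop)

/-- For `s` in a compact set, the distance to the shadow set is bounded by a multiple of the
Douglas-Rachford residual.  The triples `(s, u, v)` range over a finite union of polyhedra; Hoffman's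
bound applies on those that contain a triple with `u = v`, and on the others compactness bounds the
residual from below. -/
theorem exists_errorBound {n : ℕ} {A B : EuclideanSpace ℝ (Fin n) → Set (EuclideanSpace ℝ (Fin n))}
    (hA : IsPiecewisePolyhedral A) (hB : IsPiecewisePolyhedral B) {γ : ℝ} (hγ : γ ≠ 0)
    {f g : EuclideanSpace ℝ (Fin n) → EuclideanSpace ℝ (Fin n)} (hf : Continuous f)
    (hg : Continuous g) (hfA : ∀ s, f s ∈ resolvent γ A s) (hgB : ∀ s, g s ∈ resolvent γ B s)
    {K : Set (EuclideanSpace ℝ (Fin n))} (hK : IsCompact K) :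
    ∃ κ : ℝ, ∀ s ∈ K,
      Metric.infDist s (shadow A B γ) ≤ κ * ‖g ((2 : ℝ) • f s - s) - f s‖ := by
  let E := EuclideanSpace ℝ (Fin n)
  obtain ⟨mA, P, hP, hAP⟩ := hA
  obtain ⟨mB, Q, hQ, hBQ⟩ := hB
  -- The points of the graphs of `A` and `B` determined by a triple `(s, u, v)`.
  let φ : E × E × E →L[ℝ] WithLp 2 (E × E) :=
    (WithLp.prodContinuousLinearEquiv 2 ℝ E E).symm.toContinuousLinearMap ∘L
      ((ContinuousLinearMap.fst ℝ E E ∘L ContinuousLinearMap.snd ℝ E (E × E)).prod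
        (γ⁻¹ • (ContinuousLinearMap.fst ℝ E (E × E) -
          ContinuousLinearMap.fst ℝ E E ∘L ContinuousLinearMap.snd ℝ E (E × E))))
  let ψ : E × E × E →L[ℝ] WithLp 2 (E × E) :=
    (WithLp.prodContinuousLinearEquiv 2 ℝ E E).symm.toContinuousLinearMap ∘L
      ((ContinuousLinearMap.snd ℝ E E ∘L ContinuousLinearMap.snd ℝ E (E × E)).prod
        (γ⁻¹ • ((2 : ℝ) • (ContinuousLinearMap.fst ℝ E E ∘L ContinuousLinearMap.snd ℝ E (E × E))
          - ContinuousLinearMap.fst ℝ E (E × E)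
          - ContinuousLinearMap.snd ℝ E E ∘L ContinuousLinearMap.snd ℝ E (E × E))))
  let L : E × E × E →L[ℝ] E :=
    ContinuousLinearMap.snd ℝ E E ∘L ContinuousLinearMap.snd ℝ E (E × E)
      - ContinuousLinearMap.fst ℝ E E ∘L ContinuousLinearMap.snd ℝ E (E × E)
  let τ : E → E × E × E := fun s => (s, f s, g ((2 : ℝ) • f s - s))
  have hτ : Continuous τ := by fun_prop
  have hLτ : ∀ s, L (τ s) = g ((2 : ℝ) • f s - s) - f s := fun s => rfl
  have hshadow : ∀ x : E × E × E, φ x ∈ graph A → ψ x ∈ graph B → L x = 0 →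
      x.1 ∈ shadow A B γ := by
    rintro ⟨s, u, v⟩ h1 h2 h3
    obtain rfl : v = u := sub_eq_zero.1 h3
    exact (mem_shadow_iff hγ).2
      ⟨v, (mem_resolvent_iff hγ).2 h1, (mem_resolvent_iff hγ).2 h2⟩
  have hφτ : ∀ s, φ (τ s) ∈ graph A := fun s => (mem_resolvent_iff hγ).1 (hfA s)
  have hψτ : ∀ s, ψ (τ s) ∈ graph B := fun s => (mem_resolvent_iff hγ).1 (hgB _)
  have hpiece : ∀ i j, ∃ κ : ℝ, 0 ≤ κ ∧ ∀ s ∈ K, φ (τ s) ∈ P i → ψ (τ s) ∈ Q j →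
      Metric.infDist s (shadow A B γ) ≤ κ * ‖L (τ s)‖ := by
    intro i j
    have hPA : ∀ x, x ∈ P i → x ∈ graph A := fun x hx => by
      rw [hAP]; exact Set.mem_iUnion_of_mem i hx
    have hQB : ∀ x, x ∈ Q j → x ∈ graph B := fun x hx => by
      rw [hBQ]; exact Set.mem_iUnion_of_mem j hx
    by_cases hex : ∃ x, φ x ∈ P i ∧ ψ x ∈ Q j ∧ L x = 0
    · obtain ⟨m₁, a₁, b₁, h₁⟩ := hP i
      obtain ⟨m₂, a₂, b₂, h₂⟩ := hQ j
      let ℓ : Fin m₁ ⊕ Fin m₂ → E × E × E →L[ℝ] ℝ :=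
        Sum.elim (fun k => innerSL ℝ (a₁ k) ∘L φ) (fun k => innerSL ℝ (a₂ k) ∘L ψ)
      have hmem : ∀ x, (∀ k, ℓ k x ≤ Sum.elim b₁ b₂ k) ↔ φ x ∈ P i ∧ ψ x ∈ Q j := by
        intro x
        rw [h₁, h₂, Sum.forall]
        rfl
      obtain ⟨x₀, hx₀P, hx₀Q, hx₀⟩ := hex
      obtain ⟨κ, hκ, h⟩ := exists_polyhedron_ker_bound ℓ (Sum.elim b₁ b₂) L
        ⟨x₀, (hmem x₀).2 ⟨hx₀P, hx₀Q⟩, hx₀⟩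
      refine ⟨κ, hκ, fun s _ hsP hsQ => ?_⟩
      obtain ⟨z, hz, hz0, hzs⟩ := h (τ s) ((hmem _).2 ⟨hsP, hsQ⟩)
      obtain ⟨hzP, hzQ⟩ := (hmem z).1 hz
      calc Metric.infDist s (shadow A B γ) ≤ dist s z.1 :=
            Metric.infDist_le_dist_of_mem (hshadow z (hPA _ hzP) (hQB _ hzQ) hz0)
        _ ≤ ‖τ s - z‖ := by rw [dist_eq_norm]; exact norm_fst_le (τ s - z)
        _ ≤ κ * ‖L (τ s)‖ := hzs
    · -- On this piece the residual has no zero, so the quotient below is continuous.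
      have hC : IsCompact (K ∩ {s | φ (τ s) ∈ P i ∧ ψ (τ s) ∈ Q j}) :=
        hK.inter_right (((isClosed_of_isPolyhedral (hP i)).preimage (φ.continuous.comp hτ)).inter
          ((isClosed_of_isPolyhedral (hQ j)).preimage (ψ.continuous.comp hτ)))
      have hL0 : ∀ s ∈ K ∩ {s | φ (τ s) ∈ P i ∧ ψ (τ s) ∈ Q j}, ‖L (τ s)‖ ≠ 0 :=
        fun s hs h0 => hex ⟨τ s, hs.2.1, hs.2.2, norm_eq_zero.1 h0⟩
      have hcont : ContinuousOn (fun s => Metric.infDist s (shadow A B γ) / ‖L (τ s)‖)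
          (K ∩ {s | φ (τ s) ∈ P i ∧ ψ (τ s) ∈ Q j}) :=
        ((Metric.continuous_infDist_pt _).continuousOn).div
          ((L.continuous.comp hτ).norm.continuousOn) hL0
      obtain ⟨κ, hκ⟩ := hC.bddAbove_image hcont
      refine ⟨max κ 0, le_max_right _ _, fun s hs hsP hsQ => ?_⟩
      have hs' : s ∈ K ∩ {s | φ (τ s) ∈ P i ∧ ψ (τ s) ∈ Q j} := ⟨hs, hsP, hsQ⟩
      have h1 := hκ (Set.mem_image_of_mem _ hs')
      have hpos : 0 < ‖L (τ s)‖ := lt_of_le_of_ne (norm_nonneg _) (hL0 s hs').symm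
      exact (div_le_iff₀ hpos).1 (h1.trans (le_max_left _ _))
  choose κ hκ0 hκ using hpiece
  refine ⟨∑ i, ∑ j, κ i j, fun s hs => ?_⟩
  obtain ⟨i, hi⟩ := Set.mem_iUnion.1 (hAP ▸ hφτ s)
  obtain ⟨j, hj⟩ := Set.mem_iUnion.1 (hBQ ▸ hψτ s)
  rw [← hLτ]
  refine (hκ i j s hs hi hj).trans (mul_le_mul_of_nonneg_right ?_ (norm_nonneg _))
  calc κ i j ≤ ∑ j, κ i j :=
        Finset.single_le_sum (f := fun j => κ i j) (fun j _ => hκ0 i j) (Finset.mem_univ j)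
    _ ≤ ∑ i, ∑ j, κ i j :=
        Finset.single_le_sum (f := fun i => ∑ j, κ i j)
          (fun i _ => Finset.sum_nonneg fun j _ => hκ0 i j) (Finset.mem_univ i)

/-- A continuous operator with full domain is given by a continuous function. -/
theorem IsContinuousOp.exists_continuous {X Y : Type*} [TopologicalSpace X] [TopologicalSpace Y]
    {T : X → Set Y} (h : IsContinuousOp T) (hdom : dom T = Set.univ) :
    ∃ f : X → Y, Continuous f ∧ ∀ x, T x = {f x} := by
  obtain ⟨f, hf, hT⟩ := h
  rw [hdom] at hf hT
  exact ⟨f, continuousOn_univ.1 hf, fun x => hT x (Set.mem_univ x)⟩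

end DRS

theorem theorem3p5 (n : ℕ)
    (A B : EuclideanSpace ℝ (Fin n) → Set (EuclideanSpace ℝ (Fin n)))
    (hA : DRS.IsPiecewisePolyhedral A) (hB : DRS.IsPiecewisePolyhedral B)
    (hne : (DRS.zer (DRS.primalDual A B)).Nonempty)
    (hclosed : IsClosed (DRS.zer (DRS.primalDual A B)))
    (hconvex : Convex ℝ (DRS.zer (DRS.primalDual A B)))
    (βP βD : ℝ) (hβ : min 0 βD * min 0 βP < 1 / 4)
    (hMinty : DRS.HasObliqueWeakMinty (DRS.primalDual A B)
      (DRS.blkdiag (EuclideanSpace ℝ (Fin n)) βP βD) (DRS.zer (DRS.primalDual A B)))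
    (γ : ℝ) (hγ : γ ∈ DRS.stepsizeRange βP βD)
    (hdomA : DRS.dom (DRS.resolvent γ A) = Set.univ)
    (hdomB : DRS.dom (DRS.resolvent γ B) = Set.univ)
    (hcontA : DRS.IsContinuousOp (DRS.resolvent γ A))
    (hcontB : DRS.IsContinuousOp (DRS.resolvent γ B))
    (lam : ℕ → ℝ)
    (hlam : ∀ k, lam k ∈ Set.Ioo (0 : ℝ) (2 * DRS.relaxConst βP βD γ))
    (hliminf : 0 < Filter.liminf
      (fun k => lam k * (2 * DRS.relaxConst βP βD γ - lam k)) Filter.atTop)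
    (u v s : ℕ → EuclideanSpace ℝ (Fin n))
    (hDRS : DRS.IsDRSSequence A B γ lam u v s) :
    (∃ z ∈ DRS.zer (DRS.primalDual A B), DRS.RLinear s (z.fst - γ • z.snd)) ∧
      DRS.RLinear (fun k => ‖u k - v k‖) 0 := by
  have hγ0 : 0 < γ := DRS.pos_of_mem_stepsizeRange hγ
  obtain ⟨f, hf, hfA⟩ := hcontA.exists_continuous hdomA
  obtain ⟨g, hg, hgB⟩ := hcontB.exists_continuous hdomB
  have hu : ∀ k, u k = f (s k) := fun k => by simpa [hfA] using (hDRS k).1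
  have hv : ∀ k, v k = g ((2 : ℝ) • u k - s k) := fun k => by simpa [hgB] using (hDRS k).2.1
  have hmem : ∀ x, x ∈ DRS.shadow A B γ ↔ f x = g ((2 : ℝ) • f x - x) := fun x => by
    simp [DRS.mem_shadow_iff hγ0.ne', hfA, hgB]
  have hSne : (DRS.shadow A B γ).Nonempty := hne.image _
  -- Closedness of the shadow set comes from continuity of the resolvents.
  have hSclosed : IsClosed (DRS.shadow A B γ) := by
    have e : DRS.shadow A B γ = {x | f x = g ((2 : ℝ) • f x - x)} := Set.ext hmem
    rw [e]
    exact isClosed_eq hf (by fun_prop)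
  have hα : 0 < DRS.relaxConst βP βD γ := by
    have := (hlam 0).1.trans (hlam 0).2
    linarith
  have hfejer : ∀ k, ∀ z ∈ DRS.shadow A B γ,
      DRS.relaxConst βP βD γ * ‖v k - u k‖ ^ 2 ≤ inner ℝ (-(v k - u k)) (s k - z) :=
    fun k z hz => DRS.minty_residual hγ0 hMinty (hDRS k).1 (hDRS k).2.1 hz
  obtain ⟨z₀, hz₀⟩ := id hSne
  have hbdd : ∀ k, s k ∈ Metric.closedBall z₀ ‖s 0 - z₀‖ := fun k => by
    rw [Metric.mem_closedBall, dist_eq_norm]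
    induction k with
    | zero => exact le_rfl
    | succ k ih =>
      have h1 := DRS.norm_step_sq_le (hlam k).1.le (hfejer k z₀ hz₀)
      rw [← (hDRS k).2.2] at h1
      have h2 : 0 ≤ lam k * (2 * DRS.relaxConst βP βD γ - lam k) * ‖v k - u k‖ ^ 2 :=
        mul_nonneg (mul_nonneg (hlam k).1.le (sub_nonneg.2 (hlam k).2.le)) (sq_nonneg _)
      exact (le_of_sq_le_sq (by linarith) (norm_nonneg _)).trans ih
  obtain ⟨κ, hκ⟩ := DRS.exists_errorBound hA hB hγ0.ne' hf hg (fun x => by simp [hfA])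
    (fun x => by simp [hgB]) (isCompact_closedBall z₀ ‖s 0 - z₀‖)
  obtain ⟨ε, hε, hεlt⟩ := exists_between hliminf
  have hlamε := Filter.eventually_lt_of_lt_liminf hεlt
    (Filter.isBoundedUnder_of ⟨0, fun k =>
      mul_nonneg (hlam k).1.le (sub_nonneg.2 (hlam k).2.le)⟩)
  obtain ⟨⟨_, ⟨z, hz, rfl⟩, hs⟩, hr⟩ := DRS.rLinear_of_fejer hSclosed hSne hα hε
    (fun k => (hDRS k).2.2) hlam (hlamε.mono fun k hk => hk.le) hfejer
    (fun k => by
      have := hκ _ (hbdd k)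
      rwa [← hu, ← hv] at this)
  refine ⟨⟨z, hz, hs⟩, ?_⟩
  simpa only [norm_sub_rev (v _)] using hr
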